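/- Let $n\ge 1$, let $q\in\mathbb{C}\setminus\{0\}$, and put $\mu_{ij}=q$ if $i<j$, $\mu_{ii}=1$, $\mu_{ij}=q^{-1}$ if $i>j$. Let $A=\widetilde{\mathcal O}_q(\mathrm{GL}(n))$ be the unital associative $\mathbb{C}$-algebra with generators $a_{ij}$ $(1\le i,j\le n)$ and $D^{-1}$ and relations $$a_{ik}a_{jl}=\mu_{ij}\mu_{lk}\,a_{jl}a_{ik}\quad(\text{all } i,j,k,l),\qquad D\,D^{-1}=D^{-1}D=1,$$ where $D=\sum_{\sigma\in S_n}(-q^{-1})^{\mathrm{inv}(\sigma)}\,a_{1\sigma(1)}\cdots a_{n\sigma(n)}$ is the quantum determinant and $\mathrm{inv}(\sigma)$ is the number of inversions of $\sigma$. For an algebra $R$ and $r\in R$ let $R[r^{-1}]$ be the algebra obtained from $R$ by adjoining a two-sided inverse of $r$, and put $A_\ell=A[a_{\ell1}^{-1}]$. Then for all $\ell,m\in\{1,\dots,n\}$ there is exactly one algebra isomorphism $$\Psi_{\ell m}:A_\ell[a_{m1}^{-1}]\longrightarrow A_m[a_{\ell1}^{-1}]$$ such that $$a_{\ell k}\mapsto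 a_{\ell1}a_{m1}^{-1}a_{mk},\qquad a_{mk}\mapsto a_{m1}a_{\ell1}^{-1}a_{\ell k}\qquad(k=1,\dots,n),$$ $$a_{\ell1}^{-1}\mapsto a_{\ell1}^{-1},\qquad a_{m1}^{-1}\mapsto a_{m1}^{-1},\qquad a_{jk}\mapsto a_{jk}\quad(j\ne\ell,m;\ k=1,\dots,n),$$ and $D^{-1}\mapsto D^{-1}$ if $\ell=m$, while $D^{-1}\mapsto -D^{-1}$ if $\ell\neq m$. -/

import Mathlib

noncomputable section

namespace QuantumGL

open Finset

/-! ### The Takhtajan-Sudbery algebra -/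

/-- The coefficients `μ i j`: `q` if `i < j`, `1` if `i = j`, and `q⁻¹` if `i > j`. -/
def mu {n : ℕ} (q : ℂ) (i j : Fin n) : ℂ :=
  if i < j then q else if i = j then 1 else q⁻¹

/-- Names of the generators: the matrix entries and the inverse of the quantum determinant. -/
inductive Gen (n : ℕ) : Type
  | entry (i j : Fin n) : Gen n
  | detInv : Gen n

/-- The quantum determinant of an `n` by `n` array of elements of a `ℂ`-algebra:
the sum over all permutations `σ` of `(-q⁻¹)` to the number of inversions of `σ`, times the
ordered product `x 0 (σ 0) * x 1 (σ 1) * ⋯`. -/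
def qdet {n : ℕ} (q : ℂ) {R : Type*} [Ring R] [Algebra ℂ R] (x : Fin n → Fin n → R) : R :=
  ∑ σ : Equiv.Perm (Fin n),
    (∏ _p ∈ univ.filter (fun p : Fin n × Fin n => p.1 < p.2 ∧ σ p.2 < σ p.1), (-q⁻¹)) •
      (List.ofFn fun i => x i (σ i)).prod

/-- Defining relations. The first family is the condensed form of the quadratic relations
`a i k * a i l = q⁻¹ a i l * a i k`, `a i k * a j k = q a j k * a i k`,
`a i l * a j k = q² a j k * a i l`, `a i k * a j l = a j l * a i k` (`i < j`, `k < l`).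
The other two say that the last generator is inverse to the quantum determinant; its commutation
relations with the entries follow from these. -/
inductive Rel (n : ℕ) (q : ℂ) : FreeAlgebra ℂ (Gen n) → FreeAlgebra ℂ (Gen n) → Prop
  | comm (i j k l : Fin n) : Rel n q
      (FreeAlgebra.ι ℂ (Gen.entry i k) * FreeAlgebra.ι ℂ (Gen.entry j l))
      ((mu q i j * mu q l k) •
        (FreeAlgebra.ι ℂ (Gen.entry j l) * FreeAlgebra.ι ℂ (Gen.entry i k)))
  | det_mul_inv : Rel n q
      (qdet q (fun i j => FreeAlgebra.ι ℂ (Gen.entry i j)) * FreeAlgebra.ι ℂ Gen.detInv) 1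
  | inv_mul_det : Rel n q
      (FreeAlgebra.ι ℂ Gen.detInv * qdet q (fun i j => FreeAlgebra.ι ℂ (Gen.entry i j))) 1

/-- The Takhtajan-Sudbery algebra, the one-parameter quantum `GL(n)`, by generators
and relations. -/
def OqGL (n : ℕ) (q : ℂ) : Type := RingQuot (Rel n q)

instance (n : ℕ) (q : ℂ) : Ring (OqGL n q) := inferInstanceAs (Ring (RingQuot (Rel n q)))

instance (n : ℕ) (q : ℂ) : Algebra ℂ (OqGL n q) :=
  inferInstanceAs (Algebra ℂ (RingQuot (Rel n q)))

/-- The generator `a i j`. -/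
def a {n : ℕ} (q : ℂ) (i j : Fin n) : OqGL n q :=
  RingQuot.mkAlgHom ℂ (Rel n q) (FreeAlgebra.ι ℂ (Gen.entry i j))

/-- The generator inverse to the quantum determinant. -/
def detInv (n : ℕ) (q : ℂ) : OqGL n q :=
  RingQuot.mkAlgHom ℂ (Rel n q) (FreeAlgebra.ι ℂ Gen.detInv)

/-! ### Extension of an algebra by the inverse of an element -/

/-- Relations defining `R[r⁻¹]`: the symbols `some x` for `x` in `R` multiply and add as in `R`, and
the extra symbol `none` is a two-sided inverse of `r`. -/
inductive InvRel (R : Type) [Ring R] [Algebra ℂ R] (r : R) :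
    FreeAlgebra ℂ (Option R) → FreeAlgebra ℂ (Option R) → Prop
  | add (x y : R) : InvRel R r (FreeAlgebra.ι ℂ (some (x + y)))
      (FreeAlgebra.ι ℂ (some x) + FreeAlgebra.ι ℂ (some y))
  | mul (x y : R) : InvRel R r (FreeAlgebra.ι ℂ (some (x * y)))
      (FreeAlgebra.ι ℂ (some x) * FreeAlgebra.ι ℂ (some y))
  | scalar (c : ℂ) : InvRel R r (FreeAlgebra.ι ℂ (some (algebraMap ℂ R c)))
      (algebraMap ℂ (FreeAlgebra ℂ (Option R)) c)
  | mul_inv : InvRel R r (FreeAlgebra.ι ℂ (some r) * FreeAlgebra.ι ℂ none) 1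
  | inv_mul : InvRel R r (FreeAlgebra.ι ℂ none * FreeAlgebra.ι ℂ (some r)) 1

/-- `R[r⁻¹]`, the `ℂ`-algebra obtained from the (noncommutative) `ℂ`-algebra `R` by adjoining
universally a two-sided inverse of `r`. -/
def AdjoinInv (R : Type) [Ring R] [Algebra ℂ R] (r : R) : Type := RingQuot (InvRel R r)

namespace AdjoinInv

variable {R : Type} [Ring R] [Algebra ℂ R]

instance (r : R) : Ring (AdjoinInv R r) := inferInstanceAs (Ring (RingQuot (InvRel R r)))

instance (r : R) : Algebra ℂ (AdjoinInv R r) :=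
  inferInstanceAs (Algebra ℂ (RingQuot (InvRel R r)))

/-- The canonical algebra map from `R` to `R[r⁻¹]`. -/
def of (r : R) : R →ₐ[ℂ] AdjoinInv R r where
  toFun x := RingQuot.mkAlgHom ℂ (InvRel R r) (FreeAlgebra.ι ℂ (some x))
  map_one' := by
    have h := RingQuot.mkAlgHom_rel ℂ (InvRel.scalar (r := r) 1)
    rw [map_one, map_one, map_one] at h
    exact h
  map_mul' x y := by
    have h := RingQuot.mkAlgHom_rel ℂ (InvRel.mul (r := r) x y)
    rw [map_mul] at h
    exact h
  map_zero' := by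
    have h := RingQuot.mkAlgHom_rel ℂ (InvRel.scalar (r := r) 0)
    rw [map_zero, map_zero, map_zero] at h
    exact h
  map_add' x y := by
    have h := RingQuot.mkAlgHom_rel ℂ (InvRel.add (r := r) x y)
    rw [map_add] at h
    exact h
  commutes' c := by
    have h := RingQuot.mkAlgHom_rel ℂ (InvRel.scalar (r := r) c)
    rw [AlgHom.commutes] at h
    exact h

/-- The adjoined inverse of `r`. -/
def inv (r : R) : AdjoinInv R r :=
  RingQuot.mkAlgHom ℂ (InvRel R r) (FreeAlgebra.ι ℂ none)

theorem of_mul_inv (r : R) : of r r * inv r = 1 := by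
  have h := RingQuot.mkAlgHom_rel ℂ (InvRel.mul_inv (r := r))
  rw [map_mul, map_one] at h
  exact h

theorem inv_mul_of (r : R) : inv r * of r r = 1 := by
  have h := RingQuot.mkAlgHom_rel ℂ (InvRel.inv_mul (r := r))
  rw [map_mul, map_one] at h
  exact h

end AdjoinInv

/-! ### The algebras on the charts and on the pairwise overlaps -/

variable {n : ℕ} [NeZero n]

/-- The extension of the quantum `GL(n)` by the inverse of `a l 0`, the entry in row `l` of the
first column. -/
abbrev Chart (q : ℂ) (l : Fin n) : Type := AdjoinInv (OqGL n q) (a q l 0)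

/-- The chart algebra of `l`, extended further by the inverse of `a m 0`. -/
abbrev Overlap (q : ℂ) (l m : Fin n) : Type :=
  AdjoinInv (Chart q l) (AdjoinInv.of (a q l 0) (a q m 0))

namespace Overlap

/-- The canonical map from the quantum `GL(n)` to the algebra of the overlap. -/
def of (q : ℂ) (l m : Fin n) : OqGL n q →ₐ[ℂ] Overlap q l m :=
  (AdjoinInv.of (AdjoinInv.of (a q l 0) (a q m 0))).comp (AdjoinInv.of (a q l 0))

/-- The generator `a i k`, in the algebra of the overlap. -/
def entry (q : ℂ) (l m : Fin n) (i k : Fin n) : Overlap q l m := of q l m (a q i k)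

/-- The inverse of `a l 0`, which was adjoined first. -/
def invFst (q : ℂ) (l m : Fin n) : Overlap q l m :=
  AdjoinInv.of (AdjoinInv.of (a q l 0) (a q m 0)) (AdjoinInv.inv (a q l 0))

/-- The inverse of `a m 0`, which was adjoined second. -/
def invSnd (q : ℂ) (l m : Fin n) : Overlap q l m :=
  AdjoinInv.inv (AdjoinInv.of (a q l 0) (a q m 0))

/-- The inverse of the quantum determinant, in the algebra of the overlap. -/
def dInv (q : ℂ) (l m : Fin n) : Overlap q l m := of q l m (detInv n q)

end Overlap

end QuantumGL

end

noncomputable section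

namespace QuantumGL

open Finset

/-! ### Elements commuting up to a scalar -/

section ScalarCommute

variable {S : Type*} [Ring S] [Algebra ℂ S]

/-! By the universal properties, a map out of an overlap is a quantum array, inverses of its two
first-column entries and an inverse of its quantum determinant. So everything rests on two facts
about the array `exchange x l m u v`.

It is again a quantum array (`isQuantumArray_exchange`): the scalar by which an element commutes
with entries splits into a row factor and a column factor, so `x l 0 * v * x m k` commutes past
anything with the same scalar as `x l k`.

For `l ≠ m`, its quantum determinant is the negative of the old one (`qdet_exchange`). With a square
root `h` of `q`, each monomial can be rescaled so as not to depend on the order of its factors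
(`weylProd_perm`), and the quantum determinant becomes an ordinary signed sum of rescaled monomials
(`qdet_eq_sum_weylProd`). With rows `l` and `m` placed first, the exchange turns the monomial of `σ`
into that of `σ * swap l m` (`weylProd_exchange`), and the sign flips.

The maps for `(l, m)` and `(m, l)` are mutually inverse, and uniqueness holds because an algebra map
on an overlap is determined by the entries and the inverse determinant. -/

/-- `x` and `y` commute up to the scalar `c`. -/
def ScalarCommute (c : ℂ) (x y : S) : Prop := x * y = c • (y * x)

namespace ScalarCommute

variable {c d : ℂ} {x y z : S}

theorem mul_right (hy : ScalarCommute c x y) (hz : ScalarCommute d x z) :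
    ScalarCommute (c * d) x (y * z) := by
  unfold ScalarCommute at *
  rw [← mul_assoc, hy, smul_mul_assoc, mul_assoc, hz, mul_smul_comm, smul_smul, mul_assoc]

theorem symm (hc : c ≠ 0) (h : ScalarCommute c x y) : ScalarCommute c⁻¹ y x := by
  unfold ScalarCommute at *
  rw [h, smul_smul, inv_mul_cancel₀ hc, one_smul]

theorem inv_right (hc : c ≠ 0) (h : ScalarCommute c x y) (hyz : y * z = 1) (hzy : z * y = 1) :
    ScalarCommute c⁻¹ x z := by
  unfold ScalarCommute at *
  have : x * z = c⁻¹ • (z * (c • (y * x)) * z) := by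
    rw [mul_smul_comm, smul_mul_assoc, smul_smul, inv_mul_cancel₀ hc, one_smul, ← mul_assoc, hzy,
      one_mul]
  rw [this, ← h, mul_assoc, mul_assoc, hyz, mul_one]

end ScalarCommute

end ScalarCommute

theorem mu_ne_zero {n : ℕ} {q : ℂ} (hq : q ≠ 0) (i j : Fin n) : mu q i j ≠ 0 := by
  unfold mu
  split_ifs <;> simp [hq]

theorem mu_self {n : ℕ} (q : ℂ) (i : Fin n) : mu q i i = 1 := by simp [mu]

theorem mu_inv {n : ℕ} (q : ℂ) (i j : Fin n) : (mu q i j)⁻¹ = mu q j i := by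
  unfold mu
  rcases lt_trichotomy i j with h | h | h
  · simp [h, h.not_gt, h.ne']
  · simp [h]
  · simp [h, h.not_gt, h.ne']

theorem mu_mul_self {n : ℕ} (h : ℂ) (i j : Fin n) : mu h i j * mu h i j = mu (h * h) i j := by
  unfold mu
  split_ifs <;> simp

theorem mu_mul_mu_symm {n : ℕ} {q : ℂ} (hq : q ≠ 0) (i j : Fin n) : mu q i j * mu q j i = 1 := by
  rw [← mu_inv q i j, mul_inv_cancel₀ (mu_ne_zero hq i j)]

/-! ### Arrays satisfying the quadratic relations -/

section Array

variable {n : ℕ} {S : Type*} [Ring S] [Algebra ℂ S]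

/-- The quadratic relations for an array of elements of an algebra. -/
def IsQuantumArray (q : ℂ) (x : Fin n → Fin n → S) : Prop :=
  ∀ i j k l, ScalarCommute (mu q i j * mu q l k) (x i k) (x j l)

/-- The product of the entries `x i (σ i)` along a list of rows `i`, normalised by the square root
`h` of `q` so that it does not depend on the order of the rows. -/
def weylProd (h : ℂ) (x : Fin n → Fin n → S) (σ : Fin n → Fin n) : List (Fin n) → S
  | [] => 1
  | i :: L => (L.map fun j => mu h j i * mu h (σ i) (σ j)).prod • (x i (σ i) * weylProd h x σ L)

theorem weylProd_congr {h : ℂ} {x y : Fin n → Fin n → S} {σ τ : Fin n → Fin n}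
    {L : List (Fin n)} (hσ : ∀ i ∈ L, σ i = τ i) (hx : ∀ i ∈ L, ∀ k, x i k = y i k) :
    weylProd h x σ L = weylProd h y τ L := by
  induction L with
  | nil => rfl
  | cons i L ih =>
    rw [weylProd, weylProd, ih (fun j hj => hσ j (List.mem_cons_of_mem _ hj))
      (fun j hj => hx j (List.mem_cons_of_mem _ hj)), hσ i List.mem_cons_self,
      hx i List.mem_cons_self]
    congr 2
    exact List.map_congr_left fun j hj => by rw [hσ j (List.mem_cons_of_mem _ hj)]

/-- Swapping adjacent rows inverts the weight of that pair, while reordering the two entries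
produces the square of the inverse weight; the two effects cancel. -/
theorem weylProd_perm {h : ℂ} (hh : h ≠ 0) {x : Fin n → Fin n → S}
    (hx : IsQuantumArray (h * h) x) (σ : Fin n → Fin n) {L L' : List (Fin n)} (hL : L.Perm L') :
    weylProd h x σ L = weylProd h x σ L' := by
  induction hL with
  | nil => rfl
  | cons i hp ih => rw [weylProd, weylProd, ih, (hp.map _).prod_eq]
  | trans _ _ ih₁ ih₂ => exact ih₁.trans ih₂
  | swap i j L =>
    have hc := hx j i (σ j) (σ i)
    unfold ScalarCommute at hc
    simp only [weylProd, List.map_cons, List.prod_cons, mul_smul_comm, smul_smul, ← mul_assoc, hc,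
      smul_mul_assoc]
    congr 1
    rw [← mu_mul_self, ← mu_mul_self]
    have h1 := mu_mul_mu_symm hh i j
    have h2 := mu_mul_mu_symm hh (σ i) (σ j)
    linear_combination (mu h j i * mu h (σ i) (σ j) *
      (L.map fun k => mu h k j * mu h (σ j) (σ k)).prod *
      (L.map fun k => mu h k i * mu h (σ i) (σ k)).prod) *
        (mu h (σ i) (σ j) * mu h (σ j) (σ i) * h1 + h2)

/-- For `i < j` the row weight is `h⁻¹` and the column weight is `h` or `h⁻¹`, so a pair contributes
`1`, or `(h * h)⁻¹` if it is an inversion. -/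
theorem weylProd_of_pairwise {h : ℂ} (hh : h ≠ 0) (x : Fin n → Fin n → S)
    {σ : Fin n → Fin n} (hσ : Function.Injective σ) {L : List (Fin n)} (hL : L.Pairwise (· < ·)) :
    weylProd h x σ L =
      (∏ i ∈ L.toFinset, ∏ j ∈ L.toFinset with i < j ∧ σ j < σ i, (h * h)⁻¹) •
        (L.map fun i => x i (σ i)).prod := by
  induction L with
  | nil => simp [weylProd]
  | cons i L ih =>
    have hi : ∀ j ∈ L, i < j := (List.pairwise_cons.1 hL).1
    have hL' := (List.pairwise_cons.1 hL).2
    have hnd : L.Nodup := hL'.imp (fun h => h.ne)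
    have hiL : i ∉ L.toFinset := fun hm => (hi i (List.mem_toFinset.1 hm)).false
    rw [weylProd, ih hL', List.map_cons, List.prod_cons, mul_smul_comm, smul_smul,
      List.toFinset_cons, prod_insert hiL, filter_insert, if_neg (by simp)]
    congr 2
    · rw [← List.prod_toFinset _ hnd, prod_filter]
      refine prod_congr rfl fun j hj => ?_
      have hij := hi j (List.mem_toFinset.1 hj)
      rcases lt_or_gt_of_ne (hσ.ne hij.ne) with h1 | h1
      · simp [mu, hij, hij.not_gt, hij.ne', h1, h1.not_gt, hh]
      · simp [mu, hij, hij.not_gt, hij.ne', h1, h1.not_gt, h1.ne']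
    -- The new row `i` precedes all of `L`, so it is never the larger index of an inversion.
    · refine prod_congr rfl fun j hj => ?_
      have hij := hi j (List.mem_toFinset.1 hj)
      rw [filter_insert, if_neg (by simp [hij.not_gt])]

theorem prod_inversions_neg_one (σ : Equiv.Perm (Fin n)) :
    ∏ _p ∈ univ.filter (fun p : Fin n × Fin n => p.1 < p.2 ∧ σ p.2 < σ p.1), (-1 : ℂ) =
      ((σ.sign : ℤ) : ℂ) := by
  rw [Equiv.Perm.sign_eq_prod_prod_Ioi, prod_filter, ← univ_product_univ, prod_product]
  push_cast
  refine prod_congr rfl fun i _ => ?_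
  rw [← filter_lt_eq_Ioi, prod_filter]
  refine prod_congr rfl fun j _ => ?_
  by_cases hij : i < j
  · rcases lt_or_gt_of_ne (σ.injective.ne hij.ne) with h1 | h1
    · simp [hij, h1, h1.not_gt]
    · simp [hij, h1, h1.not_gt]
  · simp [hij]

theorem qdet_eq_sum_weylProd {h : ℂ} (hh : h ≠ 0) (x : Fin n → Fin n → S) :
    qdet (h * h) x =
      ∑ σ : Equiv.Perm (Fin n), ((σ.sign : ℤ) : ℂ) • weylProd h x σ (List.finRange n) := by
  refine sum_congr rfl fun σ _ => ?_
  rw [weylProd_of_pairwise hh x σ.injective (List.pairwise_lt_finRange n), smul_smul,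
    ← prod_inversions_neg_one, List.ofFn_eq_map]
  congr 1
  have : ∀ i : Fin n, (∏ j ∈ (List.finRange n).toFinset with i < j ∧ σ j < σ i, (h * h)⁻¹) =
      ∏ j, if i < j ∧ σ j < σ i then (h * h)⁻¹ else 1 := fun i => by
    rw [List.toFinset_finRange, prod_filter]
  rw [List.toFinset_finRange] at *
  rw [prod_congr rfl fun i _ => this i, ← prod_product', univ_product_univ,
    ← prod_filter (fun p : Fin n × Fin n => p.1 < p.2 ∧ σ p.2 < σ p.1), ← prod_mul_distrib]
  exact prod_congr rfl fun _ _ => by ring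

end Array

/-! ### Exchanging two rows -/

section Exchange

variable {n : ℕ} [NeZero n] {S : Type*} [Ring S]

/-- The array in which row `l` is replaced by `x l 0 * v * x m k`, and row `m` by
`x m 0 * u * x l k`; here `u` and `v` are meant to be the inverses of `x l 0` and `x m 0`. -/
def exchange (x : Fin n → Fin n → S) (l m : Fin n) (u v : S) (j k : Fin n) : S :=
  if j = l then x l 0 * v * x m k else if j = m then x m 0 * u * x l k else x j k

variable {x : Fin n → Fin n → S} {l m : Fin n} {u v : S}

theorem exchange_fst (k : Fin n) : exchange x l m u v l k = x l 0 * v * x m k := by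
  simp [exchange]

theorem exchange_snd (hu : x l 0 * u = 1) (hv : v * x m 0 = 1) (k : Fin n) :
    exchange x l m u v m k = x m 0 * u * x l k := by
  -- For `m = l` the first branch of `exchange` applies, and both formulas agree since `u` and `v`
  -- invert the same element.
  by_cases h : m = l
  · subst h
    rw [exchange_fst, left_inv_eq_right_inv hv hu]
  · simp [exchange, h]

theorem exchange_of_ne {j : Fin n} (hl : j ≠ l) (hm : j ≠ m) (k : Fin n) :
    exchange x l m u v j k = x j k := by
  simp [exchange, hl, hm]

variable [Algebra ℂ S]

/-- Because the scalar is a product of a row and a column factor, the contributions of `w` cancel: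
`(f a * g 0) * (f b * g 0)⁻¹ * (f b * g k) = f a * g k`. -/
theorem ScalarCommute.exchange_right {z : S} {f g : Fin n → ℂ} (hf : ∀ i, f i ≠ 0)
    (hg : ∀ k, g k ≠ 0) (hz : ∀ i k, ScalarCommute (f i * g k) z (x i k))
    (hu : x l 0 * u = 1) (hu' : u * x l 0 = 1) (hv : x m 0 * v = 1) (hv' : v * x m 0 = 1)
    (i k : Fin n) : ScalarCommute (f i * g k) z (exchange x l m u v i k) := by
  have key : ∀ (a b : Fin n) (w : S), x b 0 * w = 1 → w * x b 0 = 1 →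
      ScalarCommute (f a * g k) z (x a 0 * w * x b k) := fun a b w hw hw' => by
    have := ((hz a 0).mul_right
      ((hz b 0).inv_right (mul_ne_zero (hf b) (hg 0)) hw hw')).mul_right (hz b k)
    convert this using 1
    have := hf b
    have := hg 0
    field_simp
  unfold exchange
  split_ifs with h1 h2
  · rw [h1]; exact key l m v hv hv'
  · rw [h2]; exact key m l u hu hu'
  · exact hz i k

theorem isQuantumArray_exchange {q : ℂ} (hq : q ≠ 0) (hx : IsQuantumArray q x)
    (hu : x l 0 * u = 1) (hu' : u * x l 0 = 1) (hv : x m 0 * v = 1) (hv' : v * x m 0 = 1) :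
    IsQuantumArray q (exchange x l m u v) := by
  intro i j k s
  -- The entries are exchanged one factor at a time: first against the old array, then, after
  -- reversing the relation, against the new one.
  have h1 : ∀ j s, ScalarCommute (mu q j i * mu q k s) (x j s) (exchange x l m u v i k) :=
    fun j s => ScalarCommute.exchange_right (f := fun i => mu q j i) (g := fun k => mu q k s)
      (fun _ => mu_ne_zero hq _ _) (fun _ => mu_ne_zero hq _ _) (fun i k => hx j i s k)
      hu hu' hv hv' i k
  refine ScalarCommute.exchange_right (f := fun j => mu q i j) (g := fun s => mu q s k)
    (fun _ => mu_ne_zero hq _ _) (fun _ => mu_ne_zero hq _ _) (fun j s => ?_)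
    hu hu' hv hv' j s
  have := (h1 j s).symm (mul_ne_zero (mu_ne_zero hq _ _) (mu_ne_zero hq _ _))
  rwa [mul_inv, mu_inv, mu_inv] at this

/-- Moving `x m 0` left past `x m s` cancels `v`, and moving `x l 0` right past `x m s` cancels `u`.
The scalars from column `0` and from rows `l`, `m` cancel once the two remaining entries are
reordered. -/
theorem exchange_mul_exchange {q : ℂ} (hq : q ≠ 0) (hx : IsQuantumArray q x) (hlm : l ≠ m)
    (hu : x l 0 * u = 1) (hv' : v * x m 0 = 1) (s t : Fin n) :
    exchange x l m u v l s * exchange x l m u v m t = mu q t s • (x l t * x m s) := by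
  have e1 : x m s * x m 0 = mu q 0 s • (x m 0 * x m s) := by
    simpa [ScalarCommute, mu_self] using hx m m s 0
  have e2 : x l 0 * x m s = (mu q l m * mu q s 0) • (x m s * x l 0) := hx l m 0 s
  have e3 : x m s * x l t = (mu q m l * mu q t s) • (x l t * x m s) := hx m l s t
  have h1 := mu_mul_mu_symm hq 0 s
  have h2 := mu_mul_mu_symm hq l m
  calc exchange x l m u v l s * exchange x l m u v m t
      = x l 0 * v * (x m s * x m 0) * u * x l t := by
        simp [exchange, hlm.symm, mul_assoc]
    _ = mu q 0 s • (x l 0 * (v * x m 0) * x m s * u * x l t) := by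
        rw [e1]; simp [mul_assoc]
    _ = mu q 0 s • ((x l 0 * x m s) * u * x l t) := by rw [hv', mul_one]
    _ = (mu q 0 s * (mu q l m * mu q s 0)) • (x m s * (x l 0 * u) * x l t) := by
        rw [e2]; simp [mul_assoc, smul_smul]
    _ = (mu q 0 s * (mu q l m * mu q s 0) * (mu q m l * mu q t s)) • (x l t * x m s) := by
        rw [hu, mul_one, e3, smul_smul]
    _ = mu q t s • (x l t * x m s) := by
        congr 1
        linear_combination (mu q l m * mu q m l * mu q t s) * h1 + mu q t s * h2

theorem weylProd_exchange {h : ℂ} (hh : h ≠ 0) (hx : IsQuantumArray (h * h) x) (hlm : l ≠ m)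
    (hu : x l 0 * u = 1) (hu' : u * x l 0 = 1) (hv : x m 0 * v = 1) (hv' : v * x m 0 = 1)
    (σ : Equiv.Perm (Fin n)) :
    weylProd h (exchange x l m u v) σ (List.finRange n) =
      weylProd h x (σ * Equiv.swap l m : Equiv.Perm (Fin n)) (List.finRange n) := by
  have hq := mul_ne_zero hh hh
  set L := ((List.finRange n).erase l).erase m with hL
  have hnd : ((List.finRange n).erase l).Nodup := (List.nodup_finRange n).erase l
  have hmem : ∀ j ∈ L, j ≠ l ∧ j ≠ m := fun j hj => by
    rw [hL, hnd.mem_erase_iff, (List.nodup_finRange n).mem_erase_iff] at hj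
    exact ⟨hj.2.1, hj.1⟩
  have hperm : (List.finRange n).Perm (l :: m :: L) :=
    (List.perm_cons_erase (List.mem_finRange l)).trans (List.Perm.cons l
      (List.perm_cons_erase ((List.nodup_finRange n).mem_erase_iff.2
        ⟨hlm.symm, List.mem_finRange m⟩)))
  have hswap : ∀ j ∈ L, σ j = (σ * Equiv.swap l m : Equiv.Perm (Fin n)) j := fun j hj => by
    rw [Equiv.Perm.mul_apply, Equiv.swap_apply_of_ne_of_ne (hmem j hj).1 (hmem j hj).2]
  rw [weylProd_perm hh (isQuantumArray_exchange hq hx hu hu' hv hv') σ hperm,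
    weylProd_perm hh hx _ hperm]
  have hl : (σ * Equiv.swap l m : Equiv.Perm (Fin n)) l = σ m := by simp
  have hm : (σ * Equiv.swap l m : Equiv.Perm (Fin n)) m = σ l := by simp
  have hcoef : ∀ i k, L.map (fun j => mu h j i * mu h k
      ((σ * Equiv.swap l m : Equiv.Perm (Fin n)) j)) = L.map (fun j => mu h j i * mu h k (σ j)) :=
    fun i k => List.map_congr_left fun j hj => by rw [hswap j hj]
  simp only [weylProd, List.map_cons, List.prod_cons, mul_smul_comm, smul_smul, hl, hm, hcoef]
  rw [weylProd_congr hswap fun i hi k => exchange_of_ne (hmem i hi).1 (hmem i hi).2 k,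
    ← mul_assoc, exchange_mul_exchange hq hx hlm hu hv', smul_mul_assoc, smul_smul, ← mul_assoc]
  congr 1
  -- The scalar `mu (h * h) (σ m) (σ l)` is a square in `h`, exactly what converts the column weight
  -- of the pair for `σ` into that for the swapped permutation.
  rw [← mu_mul_self]
  have h1 := mu_mul_mu_symm hh (σ l) (σ m)
  simp only [List.prod_map_mul]
  linear_combination (mu h m l * mu h (σ m) (σ l) *
    (L.map fun j => mu h j l).prod * (L.map fun j => mu h (σ l) (σ j)).prod *
    (L.map fun j => mu h j m).prod * (L.map fun j => mu h (σ m) (σ j)).prod) * h1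

theorem qdet_exchange {q : ℂ} (hq : q ≠ 0) (hx : IsQuantumArray q x) (hlm : l ≠ m)
    (hu : x l 0 * u = 1) (hu' : u * x l 0 = 1) (hv : x m 0 * v = 1) (hv' : v * x m 0 = 1) :
    qdet q (exchange x l m u v) = -qdet q x := by
  obtain ⟨h, rfl⟩ := IsAlgClosed.exists_eq_mul_self q
  have hh : h ≠ 0 := left_ne_zero_of_mul hq
  rw [qdet_eq_sum_weylProd hh, qdet_eq_sum_weylProd hh, ← sum_neg_distrib]
  refine Fintype.sum_equiv (Equiv.mulRight (Equiv.swap l m)) _ _ fun σ => ?_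
  rw [weylProd_exchange hh hx hlm hu hu' hv hv', Equiv.coe_mulRight, Equiv.Perm.sign_mul,
    Equiv.Perm.sign_swap hlm]
  simp

end Exchange

/-! ### Universal properties -/

theorem map_qdet {n : ℕ} (q : ℂ) {R S : Type*} [Ring R] [Algebra ℂ R] [Ring S] [Algebra ℂ S]
    (f : R →ₐ[ℂ] S) (x : Fin n → Fin n → R) : f (qdet q x) = qdet q fun i j => f (x i j) := by
  simp [qdet, map_sum, map_list_prod, List.map_ofFn, Function.comp_def]

namespace OqGL

variable {n : ℕ} {q : ℂ} {S : Type*} [Ring S] [Algebra ℂ S]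

theorem isQuantumArray (n : ℕ) (q : ℂ) : IsQuantumArray q (a (n := n) q) := fun i j k l => by
  have h := RingQuot.mkAlgHom_rel ℂ (Rel.comm (q := q) i j k l)
  rw [map_mul, map_smul, map_mul] at h
  exact h

theorem qdet_mul_detInv (n : ℕ) (q : ℂ) : qdet q (a q) * detInv n q = 1 := by
  have h := RingQuot.mkAlgHom_rel ℂ (Rel.det_mul_inv (n := n) (q := q))
  rw [map_mul, map_one, map_qdet] at h
  exact h

theorem detInv_mul_qdet (n : ℕ) (q : ℂ) : detInv n q * qdet q (a q) = 1 := by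
  have h := RingQuot.mkAlgHom_rel ℂ (Rel.inv_mul_det (n := n) (q := q))
  rw [map_mul, map_one, map_qdet] at h
  exact h

/-- The map out of the free algebra that sends the matrix generators to `x` and the last
generator to `d`. -/
def freeLift (x : Fin n → Fin n → S) (d : S) : FreeAlgebra ℂ (Gen n) →ₐ[ℂ] S :=
  FreeAlgebra.lift ℂ fun
    | Gen.entry i j => x i j
    | Gen.detInv => d

theorem freeLift_entry (x : Fin n → Fin n → S) (d : S) (i j : Fin n) :
    freeLift x d (FreeAlgebra.ι ℂ (Gen.entry i j)) = x i j := by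
  simp [freeLift]

theorem freeLift_detInv (x : Fin n → Fin n → S) (d : S) :
    freeLift x d (FreeAlgebra.ι ℂ Gen.detInv) = d := by
  simp [freeLift]

/-- The algebra map out of the quantum `GL(n)` given by a quantum array and an inverse of its
quantum determinant. -/
def lift (x : Fin n → Fin n → S) (d : S) (hx : IsQuantumArray q x) (hd : qdet q x * d = 1)
    (hd' : d * qdet q x = 1) : OqGL n q →ₐ[ℂ] S :=
  RingQuot.liftAlgHom ℂ ⟨freeLift x d, fun _ _ h => by
    cases h with
    | comm i j k l =>
      simpa only [map_mul, map_smul, freeLift_entry, ScalarCommute] using hx i j k l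
    | det_mul_inv =>
      simpa only [map_mul, map_one, map_qdet, freeLift_entry, freeLift_detInv] using hd
    | inv_mul_det =>
      simpa only [map_mul, map_one, map_qdet, freeLift_entry, freeLift_detInv] using hd'⟩

variable (x : Fin n → Fin n → S) (d : S) (hx : IsQuantumArray q x) (hd : qdet q x * d = 1)
  (hd' : d * qdet q x = 1)

theorem lift_a (i j : Fin n) : lift x d hx hd hd' (a q i j) = x i j :=
  (RingQuot.liftAlgHom_mkAlgHom_apply ℂ _ _ _).trans (freeLift_entry x d i j)

theorem lift_detInv : lift x d hx hd hd' (detInv n q) = d :=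
  (RingQuot.liftAlgHom_mkAlgHom_apply ℂ _ _ _).trans (freeLift_detInv x d)

theorem algHom_ext {f g : OqGL n q →ₐ[ℂ] S} (h : ∀ i j, f (a q i j) = g (a q i j))
    (hd : f (detInv n q) = g (detInv n q)) : f = g := by
  refine RingQuot.ringQuot_ext' ℂ f g (FreeAlgebra.hom_ext (funext fun w => ?_))
  cases w with
  | entry i j => exact h i j
  | detInv => exact hd

end OqGL

namespace AdjoinInv

variable {R : Type} [Ring R] [Algebra ℂ R] {S : Type*} [Ring S] [Algebra ℂ S]

/-- The extension to `R[r⁻¹]` of an algebra map sending `r` to an invertible element. -/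
def lift {r : R} (f : R →ₐ[ℂ] S) (s : S) (h : f r * s = 1) (h' : s * f r = 1) :
    AdjoinInv R r →ₐ[ℂ] S :=
  RingQuot.liftAlgHom ℂ ⟨FreeAlgebra.lift ℂ fun o => o.elim s f, fun _ _ hr => by
    cases hr <;> simp [h, h']⟩

variable {r : R} (f : R →ₐ[ℂ] S) (s : S) (h : f r * s = 1) (h' : s * f r = 1)

theorem lift_of (y : R) : lift f s h h' (of r y) = f y :=
  (RingQuot.liftAlgHom_mkAlgHom_apply ℂ _ _ _).trans (by simp)

theorem lift_inv : lift f s h h' (inv r) = s :=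
  (RingQuot.liftAlgHom_mkAlgHom_apply ℂ _ _ _).trans (by simp)

theorem algHom_ext {f g : AdjoinInv R r →ₐ[ℂ] S} (h : f.comp (of r) = g.comp (of r)) : f = g := by
  have ho : ∀ y, f (of r y) = g (of r y) := fun y => DFunLike.congr_fun h y
  -- Two-sided inverses are unique, so the value on `inv r` is forced by the value on `r`.
  have hi : f (inv r) = g (inv r) := by
    refine left_inv_eq_right_inv (a := f (of r r)) ?_ ?_
    · rw [← map_mul, inv_mul_of, map_one]
    · rw [ho, ← map_mul, of_mul_inv, map_one]
  refine RingQuot.ringQuot_ext' ℂ f g (FreeAlgebra.hom_ext (funext fun w => ?_))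
  cases w with
  | none => exact hi
  | some y => exact ho y

end AdjoinInv

/-! ### The transition maps -/

namespace Overlap

variable {n : ℕ} [NeZero n] {q : ℂ} {l m : Fin n}

theorem entry_mul_invFst : entry q l m l 0 * invFst q l m = 1 := by
  change AdjoinInv.of _ (AdjoinInv.of _ _) * AdjoinInv.of _ _ = 1
  rw [← map_mul, AdjoinInv.of_mul_inv, map_one]

theorem invFst_mul_entry : invFst q l m * entry q l m l 0 = 1 := by
  change AdjoinInv.of _ _ * AdjoinInv.of _ (AdjoinInv.of _ _) = 1
  rw [← map_mul, AdjoinInv.inv_mul_of, map_one]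

theorem entry_mul_invSnd : entry q l m m 0 * invSnd q l m = 1 :=
  AdjoinInv.of_mul_inv _

theorem invSnd_mul_entry : invSnd q l m * entry q l m m 0 = 1 :=
  AdjoinInv.inv_mul_of _

theorem isQuantumArray_entry : IsQuantumArray q (entry q l m) := fun i j k s => by
  have h := OqGL.isQuantumArray n q i j k s
  unfold ScalarCommute at h ⊢
  unfold entry
  rw [← map_mul, h, map_smul, map_mul]

theorem qdet_mul_dInv : qdet q (entry q l m) * dInv q l m = 1 := by
  have h := congrArg (of q l m) (OqGL.qdet_mul_detInv n q)
  rwa [map_mul, map_one, map_qdet] at h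

theorem dInv_mul_qdet : dInv q l m * qdet q (entry q l m) = 1 := by
  have h := congrArg (of q l m) (OqGL.detInv_mul_qdet n q)
  rwa [map_mul, map_one, map_qdet] at h

theorem algHom_ext {S : Type*} [Ring S] [Algebra ℂ S] {f g : Overlap q l m →ₐ[ℂ] S}
    (h : ∀ i j, f (entry q l m i j) = g (entry q l m i j))
    (hd : f (dInv q l m) = g (dInv q l m)) : f = g :=
  AdjoinInv.algHom_ext (AdjoinInv.algHom_ext (OqGL.algHom_ext h hd))

variable (q l m) in
/-- The images of the matrix generators under the transition map. -/
def transitionEntry : Fin n → Fin n → Overlap q m l :=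
  -- In the target `a m 0` was inverted first, so `invSnd` is the inverse of `a l 0`.
  exchange (entry q m l) l m (invSnd q m l) (invFst q m l)

variable (q l m) in
/-- The image of the inverse of the quantum determinant under the transition map. -/
def transitionDInv : Overlap q m l := if l = m then dInv q m l else -dInv q m l

theorem transitionEntry_fst (k : Fin n) : transitionEntry q l m l k =
    entry q m l l 0 * invFst q m l * entry q m l m k :=
  exchange_fst k

theorem transitionEntry_snd (k : Fin n) : transitionEntry q l m m k =
    entry q m l m 0 * invSnd q m l * entry q m l l k :=
  exchange_snd entry_mul_invSnd invFst_mul_entry k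

/-- The first-column entries of rows `l` and `m` are fixed, so their inverses in the target serve to
extend the map to both localizations. -/
theorem transitionEntry_fst_zero : transitionEntry q l m l 0 = entry q m l l 0 := by
  rw [transitionEntry_fst, mul_assoc, invFst_mul_entry, mul_one]

theorem transitionEntry_snd_zero : transitionEntry q l m m 0 = entry q m l m 0 := by
  rw [transitionEntry_snd, mul_assoc, invSnd_mul_entry, mul_one]

theorem isQuantumArray_transitionEntry (hq : q ≠ 0) :
    IsQuantumArray q (transitionEntry q l m) :=
  isQuantumArray_exchange hq isQuantumArray_entry entry_mul_invSnd invSnd_mul_entry entry_mul_invFst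
    invFst_mul_entry

theorem qdet_transitionEntry (hq : q ≠ 0) : qdet q (transitionEntry q l m) =
    if l = m then qdet q (entry q m l) else -qdet q (entry q m l) := by
  split_ifs with h
  · subst h
    congr 1
    funext j k
    by_cases hj : j = l
    · rw [hj, transitionEntry_fst, entry_mul_invFst, one_mul]
    · exact exchange_of_ne hj hj k
  · exact qdet_exchange hq isQuantumArray_entry h entry_mul_invSnd invSnd_mul_entry
      entry_mul_invFst invFst_mul_entry

theorem qdet_mul_transitionDInv (hq : q ≠ 0) :
    qdet q (transitionEntry q l m) * transitionDInv q l m = 1 := by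
  rw [qdet_transitionEntry hq, transitionDInv]
  split_ifs
  · exact qdet_mul_dInv
  · rw [neg_mul_neg]; exact qdet_mul_dInv

theorem transitionDInv_mul_qdet (hq : q ≠ 0) :
    transitionDInv q l m * qdet q (transitionEntry q l m) = 1 := by
  rw [qdet_transitionEntry hq, transitionDInv]
  split_ifs
  · exact dInv_mul_qdet
  · rw [neg_mul_neg]; exact dInv_mul_qdet

variable (l m) in
/-- The transition map, on the quantum `GL(n)`. -/
def transitionBase (hq : q ≠ 0) : OqGL n q →ₐ[ℂ] Overlap q m l :=
  OqGL.lift (transitionEntry q l m) (transitionDInv q l m) (isQuantumArray_transitionEntry hq)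
    (qdet_mul_transitionDInv hq) (transitionDInv_mul_qdet hq)

theorem transitionBase_a (hq : q ≠ 0) (i j : Fin n) :
    transitionBase l m hq (a q i j) = transitionEntry q l m i j :=
  OqGL.lift_a _ _ _ _ _ i j

variable (l m) in
/-- The transition map, on the chart algebra. -/
def transitionChart (hq : q ≠ 0) : Chart q l →ₐ[ℂ] Overlap q m l :=
  AdjoinInv.lift (transitionBase l m hq) (invSnd q m l)
    (by rw [transitionBase_a, transitionEntry_fst_zero, entry_mul_invSnd])
    (by rw [transitionBase_a, transitionEntry_fst_zero, invSnd_mul_entry])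

variable (l m) in
/-- The transition map between the two algebras of the overlap. -/
def transition (hq : q ≠ 0) : Overlap q l m →ₐ[ℂ] Overlap q m l :=
  AdjoinInv.lift (transitionChart l m hq) (invFst q m l)
    (by rw [transitionChart, AdjoinInv.lift_of, transitionBase_a, transitionEntry_snd_zero,
      entry_mul_invFst])
    (by rw [transitionChart, AdjoinInv.lift_of, transitionBase_a, transitionEntry_snd_zero,
      invFst_mul_entry])

theorem transition_of (hq : q ≠ 0) (y : OqGL n q) :
    transition l m hq (of q l m y) = transitionBase l m hq y :=
  (AdjoinInv.lift_of _ _ _ _ _).trans (AdjoinInv.lift_of _ _ _ _ _)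

theorem transition_entry (hq : q ≠ 0) (i j : Fin n) :
    transition l m hq (entry q l m i j) = transitionEntry q l m i j :=
  (transition_of hq _).trans (transitionBase_a hq i j)

theorem transition_dInv (hq : q ≠ 0) :
    transition l m hq (dInv q l m) = transitionDInv q l m :=
  (transition_of hq _).trans (OqGL.lift_detInv _ _ _ _ _)

theorem transition_invFst (hq : q ≠ 0) : transition l m hq (invFst q l m) = invSnd q m l :=
  (AdjoinInv.lift_of _ _ _ _ _).trans (AdjoinInv.lift_inv _ _ _ _)

theorem transition_invSnd (hq : q ≠ 0) : transition l m hq (invSnd q l m) = invFst q m l :=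
  AdjoinInv.lift_inv _ _ _ _

theorem transition_comp_transition (hq : q ≠ 0) :
    (transition m l hq).comp (transition l m hq) = AlgHom.id ℂ (Overlap q l m) := by
  refine algHom_ext (fun j k => ?_) ?_
  · rw [AlgHom.comp_apply, transition_entry, AlgHom.id_apply]
    by_cases hl : j = l
    · subst hl
      rw [transitionEntry_fst, map_mul, map_mul, transition_entry, transition_entry,
        transition_invFst, transitionEntry_snd_zero, transitionEntry_fst,
        mul_assoc (entry q j m m 0), ← mul_assoc, mul_assoc (entry q j m j 0),
        invSnd_mul_entry, mul_one, ← mul_assoc, entry_mul_invFst, one_mul]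
    · by_cases hm : j = m
      · subst hm
        rw [transitionEntry_snd, map_mul, map_mul, transition_entry, transition_entry,
          transition_invSnd, transitionEntry_fst_zero, transitionEntry_snd,
          mul_assoc (entry q l j l 0), ← mul_assoc, mul_assoc (entry q l j j 0),
          invFst_mul_entry, mul_one, ← mul_assoc, entry_mul_invSnd, one_mul]
      · rw [transitionEntry, exchange_of_ne hl hm, transition_entry, transitionEntry,
          exchange_of_ne hm hl]
  · rw [AlgHom.comp_apply, transition_dInv, AlgHom.id_apply, transitionDInv]
    split_ifs with h
    · rw [transition_dInv, transitionDInv, if_pos h.symm]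
    · rw [map_neg, transition_dInv, transitionDInv, if_neg (Ne.symm h), neg_neg]

end Overlap

end QuantumGL

end

/-! ### Existence and uniqueness of the transition isomorphism -/

theorem mainTheorem9 {n : ℕ} [NeZero n] (q : ℂ) (hq : q ≠ 0) (l m : Fin n) :
    ∃! Ψ : QuantumGL.Overlap q l m ≃ₐ[ℂ] QuantumGL.Overlap q m l,
      (∀ k, Ψ (QuantumGL.Overlap.entry q l m l k) =
        QuantumGL.Overlap.entry q m l l 0 * QuantumGL.Overlap.invFst q m l *
          QuantumGL.Overlap.entry q m l m k) ∧
      Ψ (QuantumGL.Overlap.invFst q l m) = QuantumGL.Overlap.invSnd q m l ∧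
      (∀ k, Ψ (QuantumGL.Overlap.entry q l m m k) =
        QuantumGL.Overlap.entry q m l m 0 * QuantumGL.Overlap.invSnd q m l *
          QuantumGL.Overlap.entry q m l l k) ∧
      Ψ (QuantumGL.Overlap.invSnd q l m) = QuantumGL.Overlap.invFst q m l ∧
      (∀ j k, j ≠ l → j ≠ m →
        Ψ (QuantumGL.Overlap.entry q l m j k) = QuantumGL.Overlap.entry q m l j k) ∧
      Ψ (QuantumGL.Overlap.dInv q l m) =
        if l = m then QuantumGL.Overlap.dInv q m l else -QuantumGL.Overlap.dInv q m l := by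
  have hext : ∀ {f g : QuantumGL.Overlap q l m ≃ₐ[ℂ] QuantumGL.Overlap q m l},
      (f : QuantumGL.Overlap q l m →ₐ[ℂ] QuantumGL.Overlap q m l) = g → f = g :=
    fun h => AlgEquiv.ext fun y => DFunLike.congr_fun h y
  refine ⟨AlgEquiv.ofAlgHom (QuantumGL.Overlap.transition l m hq)
    (QuantumGL.Overlap.transition m l hq) (QuantumGL.Overlap.transition_comp_transition hq)
    (QuantumGL.Overlap.transition_comp_transition hq), ⟨fun k => ?_, ?_, fun k => ?_, ?_,
      fun j k hl hm => ?_, ?_⟩, ?_⟩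
  · exact (QuantumGL.Overlap.transition_entry hq l k).trans
      (QuantumGL.Overlap.transitionEntry_fst k)
  · exact QuantumGL.Overlap.transition_invFst hq
  · exact (QuantumGL.Overlap.transition_entry hq m k).trans
      (QuantumGL.Overlap.transitionEntry_snd k)
  · exact QuantumGL.Overlap.transition_invSnd hq
  · exact (QuantumGL.Overlap.transition_entry hq j k).trans
      (QuantumGL.exchange_of_ne hl hm k)
  · exact QuantumGL.Overlap.transition_dInv hq
  -- The conditions on the two adjoined inverses are discarded: they follow from those on the
  -- entries.
  · rintro Φ ⟨h1, -, h3, -, h5, h6⟩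
    refine hext (QuantumGL.Overlap.algHom_ext (fun j k => ?_) ?_)
    · refine Eq.trans ?_ (QuantumGL.Overlap.transition_entry hq j k).symm
      by_cases hl : j = l
      · subst hl
        exact (h1 k).trans (QuantumGL.Overlap.transitionEntry_fst k).symm
      · by_cases hm : j = m
        · subst hm
          exact (h3 k).trans (QuantumGL.Overlap.transitionEntry_snd k).symm
        · exact (h5 j k hl hm).trans (QuantumGL.exchange_of_ne hl hm k).symm
    · exact h6.trans (QuantumGL.Overlap.transition_dInv hq).symm
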